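/- Let $H$ be a separable infinite-dimensional complex Hilbert space. A contraction $T\in L(H)$ is *completely non-unitary* if its restriction to a non-zero reducing subspace is never unitary. For such $T$ and for a bounded analytic function $\theta$ on the open unit disk $\mathbf D$ (that is, $\theta\in H^\infty$) let $\theta(T)$ be given by the Sz.-Nagy–Foias functional calculus: $\theta(T)$ is the limit in the strong operator topology, as $r\to 1^-$, of $\theta_r(T)=\sum_{n\ge 0}a_n r^n T^n$, where $\theta(z)=\sum_{n\ge 0} a_n z^n$. An element $h\in H$ is *algebraic with respect to* $T$ if $\theta(T)h=0$ for some $\theta\in H^\infty\setminus\{0\}$, and $T$ is a *transcendental operator* if $T$ is a completely non-unitary contraction and no non-zero element of $H$ is algebraic with respect to $T$. If $T$ is a transcendental operator on $H$, then for every non-zero $h\in H$ the vectors $T^n h$, $n=0,1,2,\dots$, are linearly independent (in particular they are pairwise distinct, and the set $\{T^n h : n=0,1,2,\dots\}$ is linearly independent). -/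

import Mathlib

open Filter Topology

namespace TranscendentalOperator

/-- `θ` belongs to `H^∞`: it is a bounded analytic function on the open unit disk.
Only the values of `θ` on the disk matter. -/
def IsHInf (θ : ℂ → ℂ) : Prop :=
  DifferentiableOn ℂ θ (Metric.ball 0 1) ∧ ∃ C : ℝ, ∀ z ∈ Metric.ball (0 : ℂ) 1, ‖θ z‖ ≤ C

/-- The `n`-th Taylor coefficient of `θ` at the origin. -/
noncomputable def taylorCoeff (θ : ℂ → ℂ) (n : ℕ) : ℂ :=
  iteratedDeriv n θ 0 / (n.factorial : ℂ)

variable {H : Type*} [NormedAddCommGroup H] [InnerProductSpace ℂ H]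

/-- `θ_r(T) = ∑ aₙ rⁿ Tⁿ`, where `θ(z) = ∑ aₙ zⁿ` and `θ_r(z) = θ(r z)`. For `θ ∈ H^∞`,
`0 ≤ r < 1` and a contraction `T` the series converges absolutely in operator norm
(`summable_dilate`). -/
noncomputable def dilate (T : H →L[ℂ] H) (θ : ℂ → ℂ) (r : ℝ) : H →L[ℂ] H :=
  ∑' n : ℕ, (taylorCoeff θ n * (r : ℂ) ^ n) • T ^ n

/-- `A = θ(T)` in the Sz.-Nagy–Foias functional calculus: `θ(T)` is the limit of `θ_r(T)` in the
strong operator topology as `r → 1⁻`. For a completely non-unitary contraction `T` and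
`θ ∈ H^∞` this limit is the operator `Φ_T(θ)`. -/
def IsHInfCalculus (T : H →L[ℂ] H) (θ : ℂ → ℂ) (A : H →L[ℂ] H) : Prop :=
  ∀ x : H, Tendsto (fun r : ℝ => dilate T θ r x) (𝓝[<] 1) (𝓝 (A x))

/-- `M` is a reducing subspace for `T`: closed, and invariant under `T` and its adjoint. -/
def IsReducing [CompleteSpace H] (T : H →L[ℂ] H) (M : Submodule ℂ H) : Prop :=
  IsClosed (M : Set H) ∧ (∀ x ∈ M, T x ∈ M) ∧ ∀ x ∈ M, ContinuousLinearMap.adjoint T x ∈ M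

/-- The restriction of `T` to `M` is a unitary operator on `M`: a linear isometry of `M`
onto `M`. -/
def IsUnitaryOn (T : H →L[ℂ] H) (M : Submodule ℂ H) : Prop :=
  (∀ x ∈ M, ‖T x‖ = ‖x‖) ∧ Submodule.map (T : H →ₗ[ℂ] H) M = M

/-- `T` is a completely non-unitary contraction. -/
def IsCNUContraction [CompleteSpace H] (T : H →L[ℂ] H) : Prop :=
  ‖T‖ ≤ 1 ∧ ∀ M : Submodule ℂ H, IsReducing T M → M ≠ ⊥ → ¬ IsUnitaryOn T M

/-- `h` is algebraic with respect to `T`: `θ(T) h = 0` for some `θ ∈ H^∞ ∖ {0}`. -/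
def IsAlgebraicElement (T : H →L[ℂ] H) (h : H) : Prop :=
  ∃ θ : ℂ → ℂ, IsHInf θ ∧ (∃ z ∈ Metric.ball (0 : ℂ) 1, θ z ≠ 0) ∧
    ∃ A : H →L[ℂ] H, IsHInfCalculus T θ A ∧ A h = 0

/-- `T` is a transcendental operator: a completely non-unitary contraction without a
non-trivial (that is, non-zero) algebraic element. -/
def IsTranscendentalOperator [CompleteSpace H] (T : H →L[ℂ] H) : Prop :=
  IsCNUContraction T ∧ ∀ h : H, h ≠ 0 → ¬ IsAlgebraicElement T h

/-- The operator `θ(T)` is unique. -/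
theorem IsHInfCalculus.unique {T : H →L[ℂ] H} {θ : ℂ → ℂ} {A B : H →L[ℂ] H}
    (hA : IsHInfCalculus T θ A) (hB : IsHInfCalculus T θ B) : A = B :=
  ContinuousLinearMap.ext fun x => tendsto_nhds_unique (hA x) (hB x)

/-- The series defining `θ_r(T)` converges absolutely. -/
theorem summable_dilate {T : H →L[ℂ] H} (hT : ‖T‖ ≤ 1) {θ : ℂ → ℂ} (hθ : IsHInf θ)
    {r : ℝ} (h0 : 0 ≤ r) (h1 : r < 1) :
    Summable fun n : ℕ => ‖(taylorCoeff θ n * (r : ℂ) ^ n) • T ^ n‖ := by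
  obtain ⟨hd, C, hC⟩ := hθ
  obtain ⟨s, hrs, hs1⟩ := exists_between h1
  have hs0 : 0 < s := h0.trans_lt hrs
  have hsub : Metric.closedBall (0 : ℂ) s ⊆ Metric.ball 0 1 :=
    Metric.closedBall_subset_ball hs1
  have hcoef : ∀ n : ℕ, ‖taylorCoeff θ n‖ ≤ C / s ^ n := by
    intro n
    have hcl : DiffContOnCl ℂ θ (Metric.ball 0 s) := by
      apply DifferentiableOn.diffContOnCl
      rw [closure_ball _ hs0.ne']
      exact hd.mono hsub
    have := Complex.norm_iteratedDeriv_le_of_forall_mem_sphere_norm_le n hs0 hcl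
      (fun z hz => hC z (hsub (Metric.sphere_subset_closedBall hz)))
    have hn : (0 : ℝ) < n.factorial := by exact_mod_cast n.factorial_pos
    rw [taylorCoeff, norm_div, Complex.norm_natCast, div_le_iff₀ hn]
    calc _ ≤ _ := this
      _ = _ := by ring
  have hC0 : 0 ≤ C := (norm_nonneg _).trans (hC 0 (by simp))
  have hpow : ∀ n : ℕ, ‖T ^ n‖ ≤ 1 := by
    intro n
    induction n with
    | zero => exact ContinuousLinearMap.norm_id_le (𝕜 := ℂ) (E := H)
    | succ k ih =>
      rw [pow_succ]
      exact (norm_mul_le _ _).trans (mul_le_one₀ ih (norm_nonneg _) hT)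
  refine Summable.of_nonneg_of_le (fun _ => norm_nonneg _) (fun n => ?_)
    ((summable_geometric_of_lt_one (div_nonneg h0 hs0.le)
      ((div_lt_one hs0).2 hrs)).mul_left C)
  rw [norm_smul, norm_mul, norm_pow, Complex.norm_real, Real.norm_of_nonneg h0]
  calc ‖taylorCoeff θ n‖ * r ^ n * ‖T ^ n‖ ≤ (C / s ^ n) * r ^ n * 1 := by
        gcongr
        · exact hcoef n
        · exact hpow n
    _ = C * (r / s) ^ n := by rw [div_pow]; ring

end TranscendentalOperator

namespace Polynomial

/-! A nontrivial linear relation among the vectors `T ^ n h` says that p(T)h = 0 for some polynomial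
p ≠ 0. Such a p is bounded and analytic on the disk and not identically zero there, and by
`isHInfCalculus_polynomial` its functional calculus gives the usual p(T). So h would be algebraic,
which a transcendental operator forbids for h ≠ 0. -/

theorem iteratedDeriv_eval {𝕜 : Type*} [NontriviallyNormedField 𝕜] (p : Polynomial 𝕜) (n : ℕ) :
    iteratedDeriv n (fun z => p.eval z) = fun z => (derivative^[n] p).eval z := by
  induction n with
  | zero => simp
  | succ n ih =>
    rw [iteratedDeriv_succ, ih, Function.iterate_succ_apply']
    ext z
    exact Polynomial.deriv _

end Polynomial

namespace TranscendentalOperator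

variable {H : Type*} [NormedAddCommGroup H] [InnerProductSpace ℂ H]

theorem taylorCoeff_polynomial (p : Polynomial ℂ) (n : ℕ) :
    taylorCoeff (fun z => p.eval z) n = p.coeff n := by
  have hn : (n.factorial : ℂ) ≠ 0 := by exact_mod_cast n.factorial_ne_zero
  simp only [taylorCoeff, Polynomial.iteratedDeriv_eval]
  -- The constant term of the n-th derivative is n! times the n-th coefficient.
  rw [← Polynomial.coeff_zero_eq_eval_zero, Polynomial.coeff_iterate_derivative, div_eq_iff hn]
  simp [Nat.descFactorial_self, mul_comm]

theorem isHInf_polynomial (p : Polynomial ℂ) : IsHInf (fun z => p.eval z) := by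
  refine ⟨p.differentiable.differentiableOn, ?_⟩
  obtain ⟨C, hC⟩ := (isCompact_closedBall (0 : ℂ) 1).exists_bound_of_continuousOn
    p.continuous.continuousOn
  exact ⟨C, fun z hz => hC z (Metric.ball_subset_closedBall hz)⟩

/-- Otherwise the whole disk, an infinite set, would consist of roots. -/
theorem exists_eval_ne_zero_of_ne_zero {p : Polynomial ℂ} (hp : p ≠ 0) :
    ∃ z ∈ Metric.ball (0 : ℂ) 1, p.eval z ≠ 0 := by
  by_contra! hz
  exact hp (p.eq_zero_of_infinite_isRoot
    ((infinite_of_mem_nhds 0 (Metric.ball_mem_nhds (0 : ℂ) one_pos)).mono hz))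

theorem dilate_polynomial (T : H →L[ℂ] H) (p : Polynomial ℂ) (r : ℝ) :
    dilate T (fun z => p.eval z) r =
      ∑ n ∈ Finset.range (p.natDegree + 1), (p.coeff n * (r : ℂ) ^ n) • T ^ n := by
  simp only [dilate, taylorCoeff_polynomial]
  refine tsum_eq_sum fun n hn => ?_
  rw [p.coeff_eq_zero_of_natDegree_lt (by simpa using hn), zero_mul,
    zero_smul]

/-- On polynomials the functional calculus is polynomial evaluation. -/
theorem isHInfCalculus_polynomial (T : H →L[ℂ] H) (p : Polynomial ℂ) :
    IsHInfCalculus T (fun z => p.eval z) (Polynomial.aeval T p) := by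
  intro x
  -- Written as the value at r = 1 of a finite sum, the limit follows from continuity in r.
  have hlim : (Polynomial.aeval T p) x =
      ∑ n ∈ Finset.range (p.natDegree + 1), (p.coeff n * ((1 : ℝ) : ℂ) ^ n) • (T ^ n) x := by
    simp [Polynomial.aeval_eq_sum_range]
  have hcont : Continuous fun r : ℝ =>
      ∑ n ∈ Finset.range (p.natDegree + 1), (p.coeff n * (r : ℂ) ^ n) • (T ^ n) x := by fun_prop
  simp only [dilate_polynomial, sum_apply, smul_apply, hlim]
  exact (hcont.tendsto 1).mono_left nhdsWithin_le_nhds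

theorem isAlgebraicElement_of_aeval_eq_zero {T : H →L[ℂ] H} {p : Polynomial ℂ} (hp : p ≠ 0)
    {h : H} (hph : Polynomial.aeval T p h = 0) : IsAlgebraicElement T h :=
  ⟨fun z => p.eval z, isHInf_polynomial p, exists_eval_ne_zero_of_ne_zero hp,
    Polynomial.aeval T p, isHInfCalculus_polynomial T p, hph⟩

end TranscendentalOperator

theorem proposition1 {H : Type*} [NormedAddCommGroup H] [InnerProductSpace ℂ H] [CompleteSpace H]
    [TopologicalSpace.SeparableSpace H] (hdim : ¬ FiniteDimensional ℂ H)
    (T : H →L[ℂ] H) (hT : TranscendentalOperator.IsTranscendentalOperator T)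
    (h : H) (hh : h ≠ 0) :
    LinearIndependent ℂ (fun n : ℕ => (T ^ n) h) := by
  have key : LinearIndependent ℂ (fun n : ℕ => ((T : H →ₗ[ℂ] H) ^ n) h) := by
    rw [Polynomial.linearIndependent_powers_iff_aeval]
    intro p hp
    by_contra hp0
    refine hT.2 h hh (TranscendentalOperator.isAlgebraicElement_of_aeval_eq_zero hp0 ?_)
    -- `hp` evaluates p at the underlying linear map, the goal at the continuous one; both expand to
    -- the same finite sum.
    simpa [Polynomial.aeval_eq_sum_range, LinearMap.sum_apply, ← ContinuousLinearMap.toLinearMap_pow]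
      using hp
  simpa only [← ContinuousLinearMap.toLinearMap_pow, ContinuousLinearMap.coe_coe] using key
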